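/- Let $F$ be an algebraically closed field of characteristic zero and let $G$ be a finite abelian group. Let $M_\infty(F)$ be the algebra of matrices $(a_{ij})_{i,j\ge 1}$ over $F$ with only finitely many nonzero entries, with the usual matrix multiplication and matrix units $E_{ij}$. A $G$-grading of an $F$-algebra $A$ is a vector space decomposition $A=\bigoplus_{g\in G}A^{(g)}$ with $A^{(g)}A^{(h)}\subseteq A^{(gh)}$ for all $g,h\in G$; its support is $\mathrm{Supp}\,A=\{g\in G: A^{(g)}\neq 0\}$, and it is called fine if $\dim A^{(g)}=1$ for every $g\in\mathrm{Supp}\,A$. A $G$-grading of $M_\infty(F)$ is called elementary if there is a sequence $(g_1,g_2,\dots)$ in $G$ such that, for every $g\in G$, the component of degree $g$ is the linear span of $\{E_{ij}: g_i^{-1}g_j=g\}$. Theorem. For every $G$-grading $R=\bigoplus_{g\in G}R^{(g)}$ of the algebra $R=M_\infty(F)$ there are an integer $n\ge 1$, an elementary $G$-grading of $C=M_\infty(F)$ and a fine $G$-grading of $D=M_n(F)$ such that $\mathrm{Supp}\,C\cap\mathrm{Supp}\,D=\{1\}$ and $R$ is isomorphic, as a $G$-graded algebra, to $C\otimes_F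 D$ with the grading $(C\otimes D)^{(g)}=\sum_{hk=g}C^{(h)}\otimes D^{(k)}$; that is, there is an isomorphism of $F$-algebras $\varphi:R\to C\otimes_F D$ with $\varphi(R^{(g)})=(C\otimes D)^{(g)}$ for all $g\in G$. -/

import Mathlib

open scoped TensorProduct

/-- The space of matrices with rows and columns indexed by `ℕ`, all but finitely many of whose
entries are zero. -/
def finitarySubmodule (F : Type*) [Field F] : Submodule F (Matrix ℕ ℕ F) where
  carrier := {A | {p : ℕ × ℕ | A p.1 p.2 ≠ 0}.Finite}
  zero_mem' := by simp
  add_mem' := by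
    intro A B hA hB
    refine (hA.union hB).subset ?_
    rintro p hp
    by_contra h
    simp only [Set.mem_union, Set.mem_ofPred_eq, not_or, not_not] at h
    exact hp (by simp [h.1, h.2])
  smul_mem' := by
    intro c A hA
    refine hA.subset ?_
    intro p hp h
    exact hp (by simp [h])

/-- The type of (countably infinite) finitary matrices over `F`. -/
def FinitaryMatrix (F : Type*) [Field F] : Type _ := finitarySubmodule F

namespace FinitaryMatrix

variable {F : Type*} [Field F]

instance : AddCommGroup (FinitaryMatrix F) := inferInstanceAs (AddCommGroup (finitarySubmodule F))

instance : Module F (FinitaryMatrix F) := inferInstanceAs (Module F (finitarySubmodule F))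

/-- The underlying infinite matrix of a finitary matrix. -/
def toMatrix (A : FinitaryMatrix F) : Matrix ℕ ℕ F := A.1

@[ext] theorem ext {A B : FinitaryMatrix F} (h : ∀ i j, A.toMatrix i j = B.toMatrix i j) :
    A = B := Subtype.ext (Matrix.ext h)

@[simp] theorem toMatrix_zero : (0 : FinitaryMatrix F).toMatrix = 0 := rfl

@[simp] theorem toMatrix_add (A B : FinitaryMatrix F) :
    (A + B).toMatrix = A.toMatrix + B.toMatrix := rfl

@[simp] theorem toMatrix_smul (c : F) (A : FinitaryMatrix F) :
    (c • A).toMatrix = c • A.toMatrix := rfl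

theorem finite (A : FinitaryMatrix F) : {p : ℕ × ℕ | A.toMatrix p.1 p.2 ≠ 0}.Finite := A.2

/-- The nonzero entries of a finitary matrix lie in a finite square. -/
theorem exists_bound (A : FinitaryMatrix F) :
    ∃ N, ∀ i j, A.toMatrix i j ≠ 0 → i < N ∧ j < N := by
  obtain ⟨N, hN⟩ := (A.finite.image fun p => max p.1 p.2).bddAbove
  refine ⟨N + 1, fun i j h => ?_⟩
  have h1 : max i j ≤ N := hN ⟨(i, j), h, rfl⟩
  omega

/-- The usual matrix product; for finitary matrices all the sums are finite. -/
noncomputable instance : Mul (FinitaryMatrix F) where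
  mul A B := ⟨fun i j => ∑ᶠ k, A.toMatrix i k * B.toMatrix k j, by
    obtain ⟨N, hN⟩ := A.exists_bound
    obtain ⟨M, hM⟩ := B.exists_bound
    refine ((Set.finite_Iio N).prod (Set.finite_Iio M)).subset ?_
    rintro ⟨i, j⟩ hp
    have hp' : ∑ᶠ k, A.toMatrix i k * B.toMatrix k j ≠ 0 := hp
    obtain ⟨k, hk⟩ : ∃ k, A.toMatrix i k * B.toMatrix k j ≠ 0 := by
      by_contra! h
      exact hp' (by simp [h])
    exact ⟨(hN i k (left_ne_zero_of_mul hk)).1, (hM k j (right_ne_zero_of_mul hk)).2⟩⟩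

theorem toMatrix_mul (A B : FinitaryMatrix F) (i j : ℕ) :
    (A * B).toMatrix i j = ∑ᶠ k, A.toMatrix i k * B.toMatrix k j := rfl

theorem toMatrix_mul_left {A : FinitaryMatrix F} {N : ℕ}
    (hN : ∀ i j, A.toMatrix i j ≠ 0 → i < N ∧ j < N) (B : FinitaryMatrix F) (i j : ℕ) :
    (A * B).toMatrix i j = ∑ k ∈ Finset.range N, A.toMatrix i k * B.toMatrix k j := by
  rw [toMatrix_mul]
  refine finsum_eq_sum_of_support_subset _ fun k hk => ?_
  simpa using (hN i k (left_ne_zero_of_mul hk)).2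

theorem toMatrix_mul_right {B : FinitaryMatrix F} {N : ℕ}
    (hN : ∀ i j, B.toMatrix i j ≠ 0 → i < N ∧ j < N) (A : FinitaryMatrix F) (i j : ℕ) :
    (A * B).toMatrix i j = ∑ k ∈ Finset.range N, A.toMatrix i k * B.toMatrix k j := by
  rw [toMatrix_mul]
  refine finsum_eq_sum_of_support_subset _ fun k hk => ?_
  simpa using (hN k j (right_ne_zero_of_mul hk)).1

noncomputable instance : NonUnitalRing (FinitaryMatrix F) where
  __ := (inferInstance : AddCommGroup (FinitaryMatrix F))
  mul := (· * ·)
  left_distrib A B C := by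
    obtain ⟨N, hN⟩ := A.exists_bound
    ext i j
    simp [toMatrix_mul_left hN, mul_add, Finset.sum_add_distrib]
  right_distrib A B C := by
    obtain ⟨N, hN⟩ := C.exists_bound
    ext i j
    simp [toMatrix_mul_right hN, add_mul, Finset.sum_add_distrib]
  zero_mul A := by ext i j; simp [toMatrix_mul]
  mul_zero A := by ext i j; simp [toMatrix_mul]
  mul_assoc A B C := by
    obtain ⟨N, hN⟩ := A.exists_bound
    obtain ⟨M, hM⟩ := C.exists_bound
    ext i j
    simp only [toMatrix_mul_left hN, toMatrix_mul_right hM, Finset.sum_mul, Finset.mul_sum]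
    rw [Finset.sum_comm]
    simp only [mul_assoc]

instance : IsScalarTower F (FinitaryMatrix F) (FinitaryMatrix F) where
  smul_assoc c A B := by
    obtain ⟨N, hN⟩ := B.exists_bound
    ext i j
    simp [toMatrix_mul_right hN, Finset.mul_sum, mul_assoc]

instance : SMulCommClass F (FinitaryMatrix F) (FinitaryMatrix F) where
  smul_comm c A B := by
    obtain ⟨N, hN⟩ := A.exists_bound
    ext i j
    simp [toMatrix_mul_left hN, Finset.mul_sum, mul_left_comm]

/-- The matrix unit `E_{ij}`. -/
def unit (i j : ℕ) : FinitaryMatrix F :=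
  ⟨Matrix.single i j 1, by
    refine (Set.finite_singleton (i, j)).subset ?_
    rintro ⟨a, b⟩ h
    by_contra h'
    refine h (Matrix.single_apply_of_ne _ _ _ _ _ ?_)
    rintro ⟨rfl, rfl⟩
    exact h' rfl⟩

end FinitaryMatrix

/-- A family of subspaces `𝒜 g`, `g ∈ G`, is a `G`-grading of the (not necessarily unital or
associative) algebra `A`. -/
structure IsGrading {F G A : Type*} [Field F] [Group G] [DecidableEq G]
    [NonUnitalNonAssocRing A] [Module F A] (𝒜 : G → Submodule F A) : Prop where
  isInternal : DirectSum.IsInternal 𝒜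
  mul_mem : ∀ (g h : G) (a b : A), a ∈ 𝒜 g → b ∈ 𝒜 h → a * b ∈ 𝒜 (g * h)

/-- The support of a family of subspaces: the indices of the nonzero ones. -/
def gradingSupport {F G A : Type*} [Field F] [AddCommGroup A] [Module F A]
    (𝒜 : G → Submodule F A) : Set G := {g | 𝒜 g ≠ ⊥}

/-- A grading is fine if all its nonzero homogeneous components are one-dimensional. -/
def IsFineGrading {F G A : Type*} [Field F] [AddCommGroup A] [Module F A]
    (𝒜 : G → Submodule F A) : Prop :=
  ∀ g ∈ gradingSupport 𝒜, Module.finrank F (𝒜 g) = 1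

/-- A grading of the algebra of finitary matrices is elementary if there is a sequence
`γ` in `G` such that the component of degree `g` is spanned by the matrix units `E_{ij}` with
`γ i⁻¹ γ j = g`. -/
def IsElementaryGrading {F G : Type*} [Field F] [Group G]
    (𝒞 : G → Submodule F (FinitaryMatrix F)) : Prop :=
  ∃ γ : ℕ → G, ∀ g,
    𝒞 g = Submodule.span F {E | ∃ i j, (γ i)⁻¹ * γ j = g ∧ E = FinitaryMatrix.unit i j}

/-- The tensor product of two gradings by an abelian group: the component of degree `g` is the
sum of the subspaces `𝒜 h ⊗ ℬ k` with `h k = g`. -/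
def tensorGrading {F G A B : Type*} [Field F] [CommGroup G] [AddCommGroup A] [Module F A]
    [AddCommGroup B] [Module F B] (𝒜 : G → Submodule F A) (ℬ : G → Submodule F B) (g : G) :
    Submodule F (A ⊗[F] B) :=
  Submodule.span F {x | ∃ h k : G, h * k = g ∧ ∃ a ∈ 𝒜 h, ∃ b ∈ ℬ k, x = a ⊗ₜ[F] b}

/-- Two families of subspaces indexed by `G` define isomorphic graded algebras. -/
def GradedIsomorphic {F G A B : Type*} [Field F] [NonUnitalNonAssocRing A] [Module F A]
    [NonUnitalNonAssocRing B] [Module F B] (𝒜 : G → Submodule F A) (ℬ : G → Submodule F B) :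
    Prop :=
  ∃ φ : A →ₙₐ[F] B, Function.Bijective φ ∧ ∀ g, (𝒜 g).map (φ : A →ₗ[F] B) = ℬ g

/-! The algebra R is von Neumann regular and prime, has no identity, and every idempotent corner e R
e is a full matrix algebra, hence finite-dimensional. Regularity passes to homogeneous elements: a
quasi-inverse of an element of degree g may be taken of degree g⁻¹. So the identity component
contains idempotent local units, and finite-dimensionality of corners splits these into orthogonal
primitive idempotents of that component. Exhausting R gives a sequence f₀, f₁, ... of them whose
finite sums are local units (`exists_primitive_sequence`).

A nonzero homogeneous element between two primitive idempotents is invertible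
(`IsPrimitiveHomogeneous.exists_inverse`), so with e = f₀ the corner e R e is a graded division
algebra. As F is algebraically closed, the identity component of e R e is F e, and inverting
homogeneous elements bounds every component by dimension one
(`IsPrimitiveHomogeneous.exists_smul_eq_of_mem`). Thus D = e R e ≅ M_n(F) is finely graded, and its
support H is a subgroup of G.

Primeness joins e to each fᵢ by a homogeneous uᵢ in e R fᵢ with inverse vᵢ, and E_ij ⊗ X ↦ vᵢ X uⱼ
identifies M_∞(F) ⊗ D with R, the first factor graded by the degrees γᵢ of the uᵢ
(`IsConnectingSystem.gradedIsomorphic`). Multiplying uᵢ by homogeneous elements of D moves γᵢ freely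
inside its coset of H. With one fixed representative per coset, γᵢ⁻¹γⱼ lies in H only if γᵢ = γⱼ, so
the supports meet only in 1. -/

/-! ### Projections, Peirce corners and primitive idempotents -/

section GradedRng

variable {F G R : Type*} [Field F] [NonUnitalRing R] [Module F R]

/-- Von Neumann regularity of a not necessarily unital ring. -/
def IsVonNeumannRegular (R : Type*) [NonUnitalRing R] : Prop := ∀ a : R, ∃ y, a * y * a = a

/-- Elementwise primeness of a not necessarily unital ring. -/
def IsElementwisePrime (R : Type*) [NonUnitalRing R] : Prop :=
  ∀ a b : R, a ≠ 0 → b ≠ 0 → ∃ r, a * r * b ≠ 0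

/-- A family of linear projections onto the components of a grading. -/
structure IsProjectionFamily [Fintype G] {A : Type*} [AddCommGroup A] [Module F A]
    (𝒜 : G → Submodule F A) (π : G → A →ₗ[F] A) : Prop where
  mem : ∀ g x, π g x ∈ 𝒜 g
  sum : ∀ x, ∑ g, π g x = x
  same : ∀ g, ∀ x ∈ 𝒜 g, π g x = x
  ne : ∀ g h, g ≠ h → ∀ x ∈ 𝒜 h, π g x = 0

theorem DirectSum.IsInternal.exists_projectionFamily [Fintype G] [DecidableEq G] {A : Type*} [AddCommGroup A]
    [Module F A] {𝒜 : G → Submodule F A} (h : DirectSum.IsInternal 𝒜) :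
    ∃ π : G → A →ₗ[F] A, IsProjectionFamily 𝒜 π := by
  classical
  let := h.chooseDecomposition
  refine ⟨fun g => (𝒜 g).subtype ∘ₗ DirectSum.component F G (fun g => 𝒜 g) g ∘ₗ
    (DirectSum.decomposeLinearEquiv 𝒜).toLinearMap, ?_, ?_, ?_, ?_⟩
  · intro g x
    exact Subtype.prop _
  · intro x
    have := DirectSum.sum_support_decompose 𝒜 x
    conv_rhs => rw [← this]
    symm
    apply Finset.sum_subset (Finset.subset_univ _)
    intro g _ hg
    simpa using hg
  · intro g x hx
    exact DirectSum.decompose_of_mem_same 𝒜 hx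
  · intro g k hgk x hx
    exact DirectSum.decompose_of_mem_ne 𝒜 hx hgk.symm

/-- The projections read off the coordinates of a direct sum, which gives injectivity; their adding
up to the identity gives surjectivity. -/
theorem IsProjectionFamily.isInternal [Fintype G] [DecidableEq G] {A : Type*} [AddCommGroup A]
    [Module F A] {𝒜 : G → Submodule F A} {π : G → A →ₗ[F] A} (h : IsProjectionFamily 𝒜 π) :
    DirectSum.IsInternal 𝒜 := by
  have key (x : DirectSum G fun g => 𝒜 g) (g : G) :
      π g (DirectSum.coeAddMonoidHom 𝒜 x) = x g := by
    induction x using DirectSum.induction_on with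
    | zero => simp
    | of k y =>
      rw [DirectSum.coeAddMonoidHom_of]
      by_cases hk : g = k
      · subst hk
        rw [h.same _ _ y.2, DirectSum.of_eq_same]
      · rw [h.ne _ _ hk _ y.2, DirectSum.of_eq_of_ne _ _ _ hk]
        rfl
    | add x y hx hy => simp [hx, hy]
  constructor
  · intro x y hxy
    refine DFinsupp.ext fun g => Subtype.ext ?_
    rw [← key, ← key, hxy]
  · intro x
    refine ⟨∑ g, DirectSum.of (fun g => 𝒜 g) g ⟨π g x, h.mem g x⟩, ?_⟩
    rw [map_sum]
    simp only [DirectSum.coeAddMonoidHom_of]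
    exact h.sum x

variable [CommGroup G]

/-- The Peirce corner `e R f`. -/
def peirceCorner (F : Type*) {R : Type*} [Field F] [NonUnitalRing R] [Module F R]
    [IsScalarTower F R R] [SMulCommClass F R R] (e f : R) : Submodule F R where
  carrier := {x | e * x = x ∧ x * f = x}
  zero_mem' := by simp
  add_mem' := by
    rintro a b ⟨h1, h2⟩ ⟨h3, h4⟩
    exact ⟨by rw [mul_add, h1, h3], by rw [add_mul, h2, h4]⟩
  smul_mem' := by
    rintro c a ⟨h1, h2⟩
    exact ⟨by rw [mul_smul_comm, h1], by rw [smul_mul_assoc, h2]⟩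

/-- A primitive idempotent of the identity component of a graded ring. -/
structure IsPrimitiveHomogeneous (ℛ : G → Submodule F R) (f : R) : Prop where
  mem : f ∈ ℛ 1
  idem : f * f = f
  ne_zero : f ≠ 0
  eq_of_le : ∀ k ∈ ℛ 1, k * k = k → f * k = k → k * f = k → k ≠ 0 → k = f

/-- Homogeneous idempotents with finite-dimensional corners are sums of orthogonal primitive ones. -/
theorem IsPrimitiveHomogeneous.exists_decomposition [IsScalarTower F R R] [SMulCommClass F R R] (ℛ : G → Submodule F R)
    (hfin : ∀ e : R, e * e = e → FiniteDimensional F (peirceCorner F e e)) (n : ℕ) :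
    ∀ h ∈ ℛ 1, h * h = h → Module.finrank F (peirceCorner F h h) ≤ n →
      ∃ T : Finset R, (∀ f ∈ T, IsPrimitiveHomogeneous ℛ f) ∧
        (∀ f ∈ T, ∀ f' ∈ T, f ≠ f' → f * f' = 0) ∧ (∀ f ∈ T, h * f = f ∧ f * h = f) ∧
        ∑ f ∈ T, f = h := by
  classical
  have hlt : ∀ h k : R, h * h = h → k * k = k → h * k = k → k * h = k → k ≠ h →
      Module.finrank F (peirceCorner F k k) < Module.finrank F (peirceCorner F h h) := by
    intro h k hh hk h1 h2 hne
    have := hfin h hh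
    apply Submodule.finrank_lt_finrank_of_lt
    refine lt_of_le_of_ne ?_ ?_
    · rintro x ⟨hx1, hx2⟩
      exact ⟨by rw [← hx1, ← mul_assoc, h1], by rw [← hx2, mul_assoc, h2]⟩
    · intro e
      have : h ∈ peirceCorner F k k := e ▸ (⟨hh, hh⟩ : h ∈ peirceCorner F h h)
      exact hne (h2.symm.trans this.1)
  induction n using Nat.strong_induction_on with
  | _ n ih =>
    intro h hh hhh hn
    by_cases h0 : h = 0
    · exact ⟨∅, by simp, by simp, by simp, by simp [h0]⟩
    by_cases hprim : IsPrimitiveHomogeneous ℛ h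
    · exact ⟨{h}, by simpa using hprim, by simp, by simpa using hhh, by simp⟩
    -- A non-primitive h splits as k + (h - k), two orthogonal nonzero idempotents with strictly
    -- smaller corners, so induction on the dimension of the corner applies to both.
    obtain ⟨k, hk, hkk, hhk, hkh, hk0, hne⟩ : ∃ k ∈ ℛ 1, k * k = k ∧ h * k = k ∧ k * h = k ∧
        k ≠ 0 ∧ k ≠ h := by
      by_contra! H
      exact hprim ⟨hh, hhh, h0, H⟩
    have hkl := hlt h k hhh hkk hhk hkh hne
    have hll : (h - k) * (h - k) = h - k := by
      rw [mul_sub, sub_mul, sub_mul, hhh, hhk, hkh, hkk]; abel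
    have hhl : h * (h - k) = h - k := by rw [mul_sub, hhh, hhk]
    have hlh : (h - k) * h = h - k := by rw [sub_mul, hhh, hkh]
    have hkl0 : k * (h - k) = 0 := by rw [mul_sub, hkh, hkk, sub_self]
    have hlk0 : (h - k) * k = 0 := by rw [sub_mul, hhk, hkk, sub_self]
    have hll' := hlt h (h - k) hhh hll hhl hlh (by simpa using hk0)
    obtain ⟨T, hT1, hT2, hT3, hT4⟩ := ih _ (lt_of_lt_of_le hkl hn) k hk hkk le_rfl
    obtain ⟨T', hT1', hT2', hT3', hT4'⟩ :=
      ih _ (lt_of_lt_of_le hll' hn) (h - k) (sub_mem hh hk) hll le_rfl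
    have horth : ∀ f ∈ T, ∀ f' ∈ T', f * f' = 0 ∧ f' * f = 0 := by
      intro f hf f' hf'
      have h1 := hT3 f hf
      have h2 := hT3' f' hf'
      constructor
      · calc f * f' = (f * k) * ((h - k) * f') := by rw [h1.2, h2.1]
          _ = f * (k * (h - k)) * f' := by simp only [mul_assoc]
          _ = 0 := by rw [hkl0]; simp
      · calc f' * f = (f' * (h - k)) * (k * f) := by rw [h1.1, h2.2]
          _ = f' * ((h - k) * k) * f := by simp only [mul_assoc]
          _ = 0 := by rw [hlk0]; simp
    have hdisj : Disjoint T T' := by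
      rw [Finset.disjoint_left]
      intro f hf hf'
      exact (hT1 f hf).ne_zero ((hT1 f hf).idem ▸ (horth f hf f hf').1)
    refine ⟨T ∪ T', ?_, ?_, ?_, ?_⟩
    · intro f hf
      rcases Finset.mem_union.1 hf with hf | hf
      exacts [hT1 f hf, hT1' f hf]
    · intro f hf f' hf' hff'
      rcases Finset.mem_union.1 hf with hf | hf <;> rcases Finset.mem_union.1 hf' with hf' | hf'
      exacts [hT2 f hf f' hf' hff', (horth f hf f' hf').1, (horth f' hf' f hf).2,
        hT2' f hf f' hf' hff']
    · intro f hf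
      rcases Finset.mem_union.1 hf with hf | hf
      · have := hT3 f hf
        exact ⟨by rw [← this.1, ← mul_assoc, hhk], by rw [← this.2, mul_assoc, hkh]⟩
      · have := hT3' f hf
        exact ⟨by rw [← this.1, ← mul_assoc, hhl], by rw [← this.2, mul_assoc, hlh]⟩
    · rw [Finset.sum_union hdisj, hT4, hT4']; abel

/-- An orthogonal set of primitive homogeneous idempotents. -/
structure IsOrthogonalPrimitive (ℛ : G → Submodule F R) (T : Set R) : Prop where
  primitive : ∀ f ∈ T, IsPrimitiveHomogeneous ℛ f
  orthogonal : ∀ f ∈ T, ∀ f' ∈ T, f ≠ f' → f * f' = 0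

variable [DecidableEq G]

/-! ### Regularity of homogeneous elements and local units of degree 1 -/

namespace IsGrading

variable {ℛ : G → Submodule F R}

theorem mul_mem_one (hR : IsGrading ℛ) {a b : R} (ha : a ∈ ℛ 1) (hb : b ∈ ℛ 1) :
    a * b ∈ ℛ 1 := by
  simpa using hR.mul_mem 1 1 a b ha hb

theorem mul_mem_of_eq (hR : IsGrading ℛ) {a b : R} {g h k : G} (ha : a ∈ ℛ g) (hb : b ∈ ℛ h)
    (hk : g * h = k) : a * b ∈ ℛ k := hk ▸ hR.mul_mem g h a b ha hb

/-- In a y a = a the component of y of degree h contributes in degree g h g, which equals g only for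
h = g⁻¹; the other components of y may therefore be dropped. -/
theorem exists_homogeneous_quasiInverse [Finite G] (hR : IsGrading ℛ)
    (hreg : IsVonNeumannRegular R) {g : G} {a : R} (ha : a ∈ ℛ g) :
    ∃ y ∈ ℛ g⁻¹, a * y * a = a := by
  have := Fintype.ofFinite G
  obtain ⟨π, hπ⟩ := hR.isInternal.exists_projectionFamily
  obtain ⟨y, hy⟩ := hreg a
  refine ⟨π g⁻¹ y, hπ.mem _ _, ?_⟩
  have h1 : π g (a * y * a) = a * π g⁻¹ y * a := by
    conv_lhs => rw [← hπ.sum y, Finset.mul_sum, Finset.sum_mul, map_sum]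
    rw [Finset.sum_eq_single g⁻¹]
    · refine hπ.same _ _ (hR.mul_mem_of_eq (hR.mul_mem _ _ _ _ ha (hπ.mem _ _)) ha (by simp))
    · intro h _ hne
      refine hπ.ne g (g * h * g) (fun e => hne ?_) _
        (hR.mul_mem _ _ _ _ (hR.mul_mem _ _ _ _ ha (hπ.mem _ _)) ha)
      have : g * h = 1 := by simpa using e.symm
      exact (inv_eq_of_mul_eq_one_right this).symm
    · simp
  rw [← h1, hy, hπ.same _ _ ha]

/-- Homogeneous quasi-inverses can be chosen in the opposite corner. -/
theorem exists_quasiInverse_corner [Finite G] (hR : IsGrading ℛ) (hreg : IsVonNeumannRegular R)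
    {e f : R} (he : e ∈ ℛ 1) (hf : f ∈ ℛ 1) (hee : e * e = e) (hff : f * f = f)
    {g : G} {a : R} (ha : a ∈ ℛ g) (hea : e * a = a) (haf : a * f = a) :
    ∃ y ∈ ℛ g⁻¹, f * y = y ∧ y * e = y ∧ a * y * a = a := by
  obtain ⟨y, hy, h⟩ := hR.exists_homogeneous_quasiInverse hreg ha
  refine ⟨f * y * e, hR.mul_mem_of_eq (hR.mul_mem_of_eq hf hy (one_mul _)) he (mul_one _),
    ?_, ?_, ?_⟩
  · rw [← mul_assoc, ← mul_assoc, hff]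
  · rw [mul_assoc, hee]
  · calc a * (f * y * e) * a = (a * f) * y * (e * a) := by simp only [mul_assoc]
      _ = a := by rw [haf, hea, h]

theorem exists_homogeneous_mul_ne_zero [Finite G] (hR : IsGrading ℛ)
    (hprime : IsElementwisePrime R) {a b : R} (ha : a ≠ 0) (hb : b ≠ 0) :
    ∃ g, ∃ r ∈ ℛ g, a * r * b ≠ 0 := by
  have := Fintype.ofFinite G
  obtain ⟨π, hπ⟩ := hR.isInternal.exists_projectionFamily
  obtain ⟨r, hr⟩ := hprime a b ha hb
  by_contra! h
  apply hr
  rw [← hπ.sum r, Finset.mul_sum, Finset.sum_mul]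
  exact Finset.sum_eq_zero fun g _ => h g _ (hπ.mem g r)

/-- To enlarge a unit e by an element a, take the part b = a - e a that e misses. If y is a
quasi-inverse of b, then p = b y is idempotent with e p = 0 and p b = b. Since p e need not vanish,
the new unit is e + p - p e rather than e + p. -/
theorem exists_left_unit [Finite G] (hR : IsGrading ℛ) (hreg : IsVonNeumannRegular R)
    (S : Finset R) (hS : ∀ s ∈ S, ∃ g, s ∈ ℛ g) :
    ∃ e ∈ ℛ 1, e * e = e ∧ ∀ s ∈ S, e * s = s := by
  classical
  induction S using Finset.induction_on with
  | empty => exact ⟨0, zero_mem _, by simp, by simp⟩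
  | insert a S _ ih =>
    obtain ⟨e, he, hee, hes⟩ := ih fun s hs => hS s (Finset.mem_insert_of_mem hs)
    obtain ⟨g, ha⟩ := hS a (Finset.mem_insert_self _ _)
    have hb : a - e * a ∈ ℛ g := sub_mem ha (hR.mul_mem_of_eq he ha (one_mul _))
    have heb : e * (a - e * a) = 0 := by rw [mul_sub, ← mul_assoc, hee, sub_self]
    obtain ⟨y, hy, hyb⟩ := hR.exists_homogeneous_quasiInverse hreg hb
    generalize hbdef : a - e * a = b at *
    obtain ⟨p, hp⟩ : ∃ p, p = b * y := ⟨_, rfl⟩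
    have hp1 : p ∈ ℛ 1 := hp ▸ hR.mul_mem_of_eq hb hy (mul_inv_cancel g)
    have hpb : p * b = b := by rw [hp, hyb]
    have hep : e * p = 0 := by rw [hp, ← mul_assoc, heb, zero_mul]
    have hpp : p * p = p := by
      conv_lhs => rw [hp, ← mul_assoc, ← hp, hpb]
      exact hp.symm
    have h1 : (e + p - p * e) * e = e := by
      rw [sub_mul, add_mul, mul_assoc, hee]; abel
    have h2 : (e + p - p * e) * p = p := by
      rw [sub_mul, add_mul, mul_assoc, hep, hpp]; simp
    have h3 : (e + p - p * e) * b = b := by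
      rw [sub_mul, add_mul, mul_assoc, heb, hpb]; simp
    refine ⟨e + p - p * e, sub_mem (add_mem he hp1) (hR.mul_mem_one hp1 he), ?_, ?_⟩
    · conv_lhs => rw [mul_sub, mul_add, ← mul_assoc, h1, h2]
    · intro s hs
      rcases Finset.mem_insert.1 hs with rfl | hs
      · have : s = b + e * s := by rw [← hbdef]; abel
        conv_lhs => rw [this, mul_add, ← mul_assoc, h1, h3, ← this]
      · rw [← hes s hs, ← mul_assoc, h1]

theorem exists_right_unit [Finite G] (hR : IsGrading ℛ) (hreg : IsVonNeumannRegular R)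
    (S : Finset R) (hS : ∀ s ∈ S, ∃ g, s ∈ ℛ g) :
    ∃ e ∈ ℛ 1, e * e = e ∧ ∀ s ∈ S, s * e = s := by
  classical
  induction S using Finset.induction_on with
  | empty => exact ⟨0, zero_mem _, by simp, by simp⟩
  | insert a S _ ih =>
    obtain ⟨e, he, hee, hes⟩ := ih fun s hs => hS s (Finset.mem_insert_of_mem hs)
    obtain ⟨g, ha⟩ := hS a (Finset.mem_insert_self _ _)
    have hb : a - a * e ∈ ℛ g := sub_mem ha (hR.mul_mem_of_eq ha he (mul_one _))
    have heb : (a - a * e) * e = 0 := by rw [sub_mul, mul_assoc, hee, sub_self]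
    obtain ⟨y, hy, hyb⟩ := hR.exists_homogeneous_quasiInverse hreg hb
    generalize hbdef : a - a * e = b at *
    obtain ⟨p, hp⟩ : ∃ p, p = y * b := ⟨_, rfl⟩
    have hp1 : p ∈ ℛ 1 := hp ▸ hR.mul_mem_of_eq hy hb (inv_mul_cancel g)
    have hpb : b * p = b := by rw [hp, ← mul_assoc, hyb]
    have hep : p * e = 0 := by rw [hp, mul_assoc, heb, mul_zero]
    have hpp : p * p = p := by
      conv_lhs => rw [hp, mul_assoc, ← hp, hpb]
      exact hp.symm
    have h1 : e * (e + p - e * p) = e := by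
      rw [mul_sub, mul_add, ← mul_assoc, hee]; abel
    have h2 : p * (e + p - e * p) = p := by
      rw [mul_sub, mul_add, ← mul_assoc, hep, hpp]; simp
    have h3 : b * (e + p - e * p) = b := by
      rw [mul_sub, mul_add, ← mul_assoc, heb, hpb]; simp
    refine ⟨e + p - e * p, sub_mem (add_mem he hp1) (hR.mul_mem_one he hp1), ?_, ?_⟩
    · conv_lhs => rw [sub_mul, add_mul, mul_assoc, h1, h2]
    · intro s hs
      rcases Finset.mem_insert.1 hs with rfl | hs
      · have : s = b + s * e := by rw [← hbdef]; abel
        conv_lhs => rw [this, add_mul, mul_assoc, h1, h3, ← this]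
      · rw [← hes s hs, mul_assoc, h1]

/-- A regular graded ring has idempotent local units in its identity component. -/
theorem exists_local_unit [Finite G] (hR : IsGrading ℛ) (hreg : IsVonNeumannRegular R)
    (S : Finset R) : ∃ e ∈ ℛ 1, e * e = e ∧ ∀ s ∈ S, e * s = s ∧ s * e = s := by
  classical
  have := Fintype.ofFinite G
  obtain ⟨π, hπ⟩ := hR.isInternal.exists_projectionFamily
  let S' : Finset R := S.biUnion fun s => Finset.univ.image fun g => π g s
  have hS' : ∀ s ∈ S', ∃ g, s ∈ ℛ g := by
    intro s hs
    simp only [S', Finset.mem_biUnion, Finset.mem_image] at hs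
    obtain ⟨t, _, g, _, rfl⟩ := hs
    exact ⟨g, hπ.mem g t⟩
  obtain ⟨f, hf, hff, hfs⟩ := hR.exists_right_unit hreg S' hS'
  -- Including f among the elements fixed by e gives e f = f, which makes e + f - f e idempotent; it
  -- is then a unit on both sides.
  obtain ⟨e, he, hee, hes⟩ := hR.exists_left_unit hreg (insert f S') (by
    intro s hs
    rcases Finset.mem_insert.1 hs with rfl | hs
    · exact ⟨1, hf⟩
    · exact hS' s hs)
  have hef := hes f (Finset.mem_insert_self _ _)
  have key : ∀ s ∈ S', (e + f - f * e) * s = s ∧ s * (e + f - f * e) = s := by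
    intro s hs
    have h1 := hfs s hs
    have h2 := hes s (Finset.mem_insert_of_mem hs)
    constructor
    · rw [sub_mul, add_mul, mul_assoc, h2]; abel
    · rw [mul_sub, mul_add, ← mul_assoc, h1]; abel
  refine ⟨e + f - f * e, sub_mem (add_mem he hf) (hR.mul_mem_one hf he), ?_, ?_⟩
  · have h1 : (e + f - f * e) * e = e := by
      rw [sub_mul, add_mul, mul_assoc, hee]; abel
    have h2 : (e + f - f * e) * f = f := by
      rw [sub_mul, add_mul, mul_assoc, hef, hff]; abel
    conv_lhs => rw [mul_sub, mul_add, ← mul_assoc, h1, h2]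
  · intro s hs
    have hmem (g : G) : π g s ∈ S' :=
      Finset.mem_biUnion.2 ⟨s, hs, Finset.mem_image_of_mem _ (Finset.mem_univ g)⟩
    constructor
    · conv_lhs => rw [← hπ.sum s, Finset.mul_sum]
      rw [Finset.sum_congr rfl fun g _ => (key _ (hmem g)).1, hπ.sum]
    · conv_lhs => rw [← hπ.sum s, Finset.sum_mul]
      rw [Finset.sum_congr rfl fun g _ => (key _ (hmem g)).2, hπ.sum]

variable [IsScalarTower F R R] [SMulCommClass F R R]

/-- A local unit e for S and T together lies above the sum p of T. Splitting e - p into primitives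
adds idempotents orthogonal to T, and the enlarged family sums to e. -/
theorem exists_orthogonalPrimitive_extension [Finite G] (hR : IsGrading ℛ)
    (hreg : IsVonNeumannRegular R)
    (hfin : ∀ e : R, e * e = e → FiniteDimensional F (peirceCorner F e e))
    (T : Finset R) (hT : IsOrthogonalPrimitive ℛ (T : Set R)) (S : Finset R) :
    ∃ T' : Finset R, T ⊆ T' ∧ IsOrthogonalPrimitive ℛ (T' : Set R) ∧
      ∀ s ∈ S, (∑ f ∈ T', f) * s = s ∧ s * (∑ f ∈ T', f) = s := by
  classical
  obtain ⟨e, he, hee, hes⟩ := hR.exists_local_unit hreg (S ∪ T)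
  obtain ⟨p, hp⟩ : ∃ p, p = ∑ f ∈ T, f := ⟨_, rfl⟩
  have hp1 : p ∈ ℛ 1 := hp ▸ sum_mem fun f hf => (hT.primitive f hf).mem
  have hpT : ∀ f ∈ T, p * f = f ∧ f * p = f := by
    intro f hf
    have hff := (hT.primitive f hf).idem
    constructor
    · rw [hp, Finset.sum_mul, Finset.sum_eq_single f, hff]
      · intro f' hf' hne
        exact hT.orthogonal f' hf' f hf hne
      · exact fun h => absurd hf h
    · rw [hp, Finset.mul_sum, Finset.sum_eq_single f, hff]
      · intro f' hf' hne
        exact hT.orthogonal f hf f' hf' hne.symm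
      · exact fun h => absurd hf h
  have hpp : p * p = p := by
    conv_lhs => rhs; rw [hp]
    rw [Finset.mul_sum, Finset.sum_congr rfl fun f hf => (hpT f hf).1, ← hp]
  have hep : e * p = p := by
    rw [hp, Finset.mul_sum]
    exact Finset.sum_congr rfl fun f hf => (hes f (Finset.mem_union_right _ hf)).1
  have hpe : p * e = p := by
    rw [hp, Finset.sum_mul]
    exact Finset.sum_congr rfl fun f hf => (hes f (Finset.mem_union_right _ hf)).2
  have hll : (e - p) * (e - p) = e - p := by
    rw [mul_sub, sub_mul, sub_mul, hee, hep, hpe, hpp]; abel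
  have hpl0 : p * (e - p) = 0 := by rw [mul_sub, hpe, hpp, sub_self]
  have hlp0 : (e - p) * p = 0 := by rw [sub_mul, hep, hpp, sub_self]
  obtain ⟨U, hU1, hU2, hU3, hU4⟩ := IsPrimitiveHomogeneous.exists_decomposition ℛ hfin _ (e - p)
    (sub_mem he hp1) hll le_rfl
  have horth : ∀ f ∈ T, ∀ f' ∈ U, f * f' = 0 ∧ f' * f = 0 := by
    intro f hf f' hf'
    have h1 := hpT f hf
    have h2 := hU3 f' hf'
    constructor
    · calc f * f' = (f * p) * ((e - p) * f') := by rw [h1.2, h2.1]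
        _ = f * (p * (e - p)) * f' := by simp only [mul_assoc]
        _ = 0 := by rw [hpl0]; simp
    · calc f' * f = (f' * (e - p)) * (p * f) := by rw [h1.1, h2.2]
        _ = f' * ((e - p) * p) * f := by simp only [mul_assoc]
        _ = 0 := by rw [hlp0]; simp
  have hdisj : Disjoint T U := by
    rw [Finset.disjoint_left]
    intro f hf hf'
    exact (hU1 f hf').ne_zero ((hU1 f hf').idem ▸ (horth f hf f hf').1)
  refine ⟨T ∪ U, Finset.subset_union_left, ⟨?_, ?_⟩, ?_⟩
  · intro f hf
    rcases Finset.mem_union.1 hf with hf | hf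
    exacts [hT.primitive f hf, hU1 f hf]
  · intro f hf f' hf' hff'
    rcases Finset.mem_union.1 hf with hf | hf <;> rcases Finset.mem_union.1 hf' with hf' | hf'
    exacts [hT.orthogonal f hf f' hf' hff', (horth f hf f' hf').1, (horth f' hf' f hf).2,
      hU2 f hf f' hf' hff']
  · intro s hs
    rw [Finset.sum_union hdisj, hU4, ← hp, add_sub_cancel]
    exact hes s (Finset.mem_union_left _ hs)

end IsGrading

/-! ### Primitive corners as graded division algebras -/

namespace IsPrimitiveHomogeneous

variable {ℛ : G → Submodule F R}

/-- A nonzero homogeneous element between primitive idempotents is invertible. -/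
theorem exists_inverse [Finite G] (hR : IsGrading ℛ) (hreg : IsVonNeumannRegular R) {e f : R}
    (he : IsPrimitiveHomogeneous ℛ e) (hf : IsPrimitiveHomogeneous ℛ f) {g : G} {a : R}
    (ha : a ∈ ℛ g) (hea : e * a = a) (haf : a * f = a) (ha0 : a ≠ 0) :
    ∃ y ∈ ℛ g⁻¹, f * y = y ∧ y * e = y ∧ a * y = e ∧ y * a = f := by
  obtain ⟨y, hy, hfy, hye, h⟩ :=
    hR.exists_quasiInverse_corner hreg he.mem hf.mem he.idem hf.idem ha hea haf
  refine ⟨y, hy, hfy, hye, ?_, ?_⟩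
  -- Both a y and y a are nonzero idempotents of degree 1, lying below e and f respectively, so
  -- primitivity leaves no choice.
  · refine he.eq_of_le _ (hR.mul_mem_of_eq ha hy (mul_inv_cancel g)) ?_ ?_ ?_ ?_
    · rw [← mul_assoc, h]
    · rw [← mul_assoc, hea]
    · rw [mul_assoc, hye]
    · intro h0
      rw [h0, zero_mul] at h
      exact ha0 h.symm
  · refine hf.eq_of_le _ (hR.mul_mem_of_eq hy ha (inv_mul_cancel g)) ?_ ?_ ?_ ?_
    · rw [mul_assoc, ← mul_assoc a, h]
    · rw [← mul_assoc, hfy]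
    · rw [mul_assoc, haf]
    · intro h0
      rw [mul_assoc, h0, mul_zero] at h
      exact ha0 h.symm

variable [IsScalarTower F R R] [SMulCommClass F R R]

/-- Over an algebraically closed field the identity component of a primitive corner consists of
scalars. -/
theorem exists_smul_eq [IsAlgClosed F] [Finite G] (hR : IsGrading ℛ)
    (hreg : IsVonNeumannRegular R) {f : R} (hf : IsPrimitiveHomogeneous ℛ f)
    [FiniteDimensional F (peirceCorner F f f)] {a : R} (ha : a ∈ ℛ 1) (hfa : f * a = a)
    (haf : a * f = a) : ∃ c : F, a = c • f := by
  let L : Module.End F (peirceCorner F f f) :=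
    (LinearMap.mulLeft F a).restrict fun x hx =>
      ⟨by rw [LinearMap.mulLeft_apply, ← mul_assoc, hfa],
        by rw [LinearMap.mulLeft_apply, mul_assoc, hx.2]⟩
  have : Nontrivial (peirceCorner F f f) :=
    ⟨⟨⟨f, hf.idem, hf.idem⟩, 0, fun h => hf.ne_zero (congrArg Subtype.val h)⟩⟩
  obtain ⟨c, hc⟩ := Module.End.exists_eigenvalue L
  obtain ⟨x, hx⟩ := hc.exists_hasEigenvector
  have hax : a * x.1 = c • x.1 := congrArg Subtype.val hx.apply_eq_smul
  refine ⟨c, ?_⟩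
  -- For an eigenvalue c of left multiplication by a, the element a - c f kills an eigenvector; were
  -- it nonzero, it would be invertible.
  by_contra hne
  obtain ⟨y, -, -, -, -, hya⟩ := hf.exists_inverse hR hreg hf (g := 1) (a := a - c • f)
    (sub_mem ha (Submodule.smul_mem _ _ hf.mem))
    (by rw [mul_sub, hfa, mul_smul_comm, hf.idem]) (by rw [sub_mul, haf, smul_mul_assoc, hf.idem])
    (sub_ne_zero.2 hne)
  apply hx.2
  apply Subtype.ext
  calc x.1 = f * x.1 := x.2.1.symm
    _ = y * ((a - c • f) * x.1) := by
      rw [← mul_assoc]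
      exact congrArg (· * x.1) hya.symm
    _ = 0 := by rw [sub_mul, hax, smul_mul_assoc, x.2.1, sub_self, mul_zero]

/-- The homogeneous components of a primitive corner are at most one-dimensional. -/
theorem exists_smul_eq_of_mem [IsAlgClosed F] [Finite G] (hR : IsGrading ℛ)
    (hreg : IsVonNeumannRegular R) {f : R} (hf : IsPrimitiveHomogeneous ℛ f)
    [FiniteDimensional F (peirceCorner F f f)] {g : G} {a b : R} (ha : a ∈ ℛ g) (hb : b ∈ ℛ g)
    (hfa : a ∈ peirceCorner F f f) (hfb : b ∈ peirceCorner F f f) (ha0 : a ≠ 0) :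
    ∃ c : F, b = c • a := by
  obtain ⟨y, hy, hfy, hyf, hay, hya⟩ := hf.exists_inverse hR hreg hf ha hfa.1 hfa.2 ha0
  -- Multiplication by the inverse y of a moves b into degree 1, where only scalars occur.
  obtain ⟨c, hc⟩ := hf.exists_smul_eq hR hreg
    (hR.mul_mem_of_eq hb hy (mul_inv_cancel g)) (by rw [← mul_assoc, hfb.1])
    (by rw [mul_assoc, hyf])
  refine ⟨c, ?_⟩
  calc b = b * y * a := by rw [mul_assoc, hya, hfb.2]
    _ = c • a := by rw [hc, smul_mul_assoc, hfa.1]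

end IsPrimitiveHomogeneous

end GradedRng

/-! ### Quasi-inverses and idempotents of finite matrices -/

section FiniteMatrices

variable {F : Type*} [Field F]

/-- A quasi-inverse is a linear projection onto the image of M followed by a section of M over that
image. -/
theorem Matrix.exists_quasiInverse {N : ℕ} (M : Matrix (Fin N) (Fin N) F) :
    ∃ Y, M * Y * M = M := by
  let f := Matrix.toLin' M
  obtain ⟨s, hs⟩ := f.rangeRestrict.exists_rightInverse_of_surjective f.range_rangeRestrict
  obtain ⟨p, hp⟩ := (LinearMap.range f).subtype.exists_leftInverse_of_injective
    (Submodule.ker_subtype _)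
  have key : f ∘ₗ (s ∘ₗ p) ∘ₗ f = f := by
    ext1 i
    apply LinearMap.ext
    intro x
    simp only [LinearMap.comp_apply]
    have h1 : ∀ z, p (f z) = f.rangeRestrict z := fun z =>
      LinearMap.congr_fun hp (f.rangeRestrict z)
    have h2 : ∀ z, f (s z) = z.1 := fun z => congrArg Subtype.val (LinearMap.congr_fun hs z)
    rw [h1, h2]
    rfl
  refine ⟨LinearMap.toMatrix' (s ∘ₗ p), ?_⟩
  have := congrArg LinearMap.toMatrix' key
  rw [LinearMap.toMatrix'_comp, LinearMap.toMatrix'_comp, LinearMap.toMatrix'_toLin',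
    ← Matrix.mul_assoc] at this
  exact this

/-- The idempotent is factored through its image: Q maps onto it in coordinates and P includes it.
Since M is the identity on its image, Q P = 1. -/
theorem Matrix.exists_idempotent_factorization {N : ℕ} {M : Matrix (Fin N) (Fin N) F}
    (hM : M * M = M) : ∃ (n : ℕ) (P : Matrix (Fin N) (Fin n) F) (Q : Matrix (Fin n) (Fin N) F),
      P * Q = M ∧ Q * P = 1 := by
  let f := Matrix.toLin' M
  have hf : ∀ x, f (f x) = f x := by
    intro x
    simp [f, hM]
  let b := Module.finBasis F (LinearMap.range f)
  let p := (LinearMap.range f).subtype ∘ₗ b.equivFun.symm.toLinearMap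
  let q := b.equivFun.toLinearMap ∘ₗ f.rangeRestrict
  have hpq : p ∘ₗ q = f := by
    apply LinearMap.ext
    intro x
    simp [p, q]
  have hqp : q ∘ₗ p = LinearMap.id := by
    apply LinearMap.ext
    intro x
    have : f.rangeRestrict (b.equivFun.symm x).1 = b.equivFun.symm x := by
      obtain ⟨y, hy⟩ := (b.equivFun.symm x).2
      apply Subtype.ext
      change f _ = _
      rw [← hy, hf]
    change b.equivFun (f.rangeRestrict (b.equivFun.symm x).1) = x
    rw [this, LinearEquiv.apply_symm_apply]
  refine ⟨_, LinearMap.toMatrix' p, LinearMap.toMatrix' q, ?_, ?_⟩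
  · rw [← LinearMap.toMatrix'_comp, hpq, LinearMap.toMatrix'_toLin']
  · rw [← LinearMap.toMatrix'_comp, hqp, LinearMap.toMatrix'_id]

end FiniteMatrices

/-! ### Regularity, primeness and corners of finitary matrices -/

namespace FinitaryMatrix

variable {F : Type*} [Field F]

/-- The finitary matrix with given entries. -/
def ofEntries (A : Matrix ℕ ℕ F) (hA : {p : ℕ × ℕ | A p.1 p.2 ≠ 0}.Finite) : FinitaryMatrix F :=
  ⟨A, hA⟩

theorem toMatrix_ofEntries (A : Matrix ℕ ℕ F) (hA : {p : ℕ × ℕ | A p.1 p.2 ≠ 0}.Finite) :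
    (ofEntries A hA).toMatrix = A := rfl

/-- The finitary matrix with a given upper left `N × N` block and zeros elsewhere. -/
def ofBlock (N : ℕ) : Matrix (Fin N) (Fin N) F →ₗ[F] FinitaryMatrix F where
  toFun M := ofEntries
    (.of fun i j => if h : i < N ∧ j < N then M ⟨i, h.1⟩ ⟨j, h.2⟩ else 0) (by
      refine ((Set.finite_Iio N).prod (Set.finite_Iio N)).subset ?_
      rintro ⟨i, j⟩ hp
      by_contra h
      exact hp (dif_neg h))
  map_add' M M' := by
    ext i j
    by_cases h : i < N ∧ j < N <;> simp [toMatrix_ofEntries, h]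
  map_smul' c M := by
    ext i j
    by_cases h : i < N ∧ j < N <;> simp [toMatrix_ofEntries, h]

theorem toMatrix_ofBlock {N : ℕ} (M : Matrix (Fin N) (Fin N) F) (i j : ℕ) :
    (ofBlock N M).toMatrix i j = if h : i < N ∧ j < N then M ⟨i, h.1⟩ ⟨j, h.2⟩ else 0 := rfl

theorem ofBlock_bound {N : ℕ} (M : Matrix (Fin N) (Fin N) F) (i j : ℕ)
    (h : (ofBlock N M).toMatrix i j ≠ 0) : i < N ∧ j < N := by
  by_contra h'
  exact h (dif_neg h')

theorem ofBlock_mul {N : ℕ} (M M' : Matrix (Fin N) (Fin N) F) :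
    ofBlock N (M * M') = ofBlock N M * ofBlock N M' := by
  ext i j
  rw [toMatrix_mul_left (ofBlock_bound M), Finset.sum_range]
  simp only [toMatrix_ofBlock, Matrix.mul_apply]
  by_cases hi : i < N <;> by_cases hj : j < N <;> simp [hi, hj]

theorem ofBlock_injective (N : ℕ) : Function.Injective (ofBlock (F := F) N) := by
  intro M M' h
  ext i j
  have := congrArg (fun A => A.toMatrix i j) h
  simpa [toMatrix_ofBlock] using this

theorem exists_ofBlock {N : ℕ} {A : FinitaryMatrix F}
    (hN : ∀ i j, A.toMatrix i j ≠ 0 → i < N ∧ j < N) : ∃ M, ofBlock N M = A := by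
  refine ⟨.of fun i j => A.toMatrix i j, ?_⟩
  ext i j
  rw [toMatrix_ofBlock]
  split_ifs with h
  · rfl
  · by_contra h'
    exact h (hN i j fun e => h' e.symm)

theorem isVonNeumannRegular : IsVonNeumannRegular (FinitaryMatrix F) := by
  intro A
  obtain ⟨N, hN⟩ := A.exists_bound
  obtain ⟨M, rfl⟩ := exists_ofBlock hN
  obtain ⟨Y, hY⟩ := M.exists_quasiInverse
  exact ⟨ofBlock N Y, by rw [← ofBlock_mul, ← ofBlock_mul, hY]⟩

theorem toMatrix_unit (i j a b : ℕ) :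
    (unit i j : FinitaryMatrix F).toMatrix a b = if i = a ∧ j = b then 1 else 0 := by
  change Matrix.single i j 1 a b = _
  rw [Matrix.single_apply]

theorem toMatrix_mul_unit (A : FinitaryMatrix F) (i j a b : ℕ) :
    (A * unit i j).toMatrix a b = if j = b then A.toMatrix a i else 0 := by
  rw [toMatrix_mul, finsum_eq_single _ i]
  · simp [toMatrix_unit]
  · intro k hk
    simp [toMatrix_unit, hk.symm]

theorem toMatrix_unit_mul (A : FinitaryMatrix F) (i j a b : ℕ) :
    (unit i j * A).toMatrix a b = if i = a then A.toMatrix j b else 0 := by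
  rw [toMatrix_mul, finsum_eq_single _ j]
  · simp [toMatrix_unit]
  · intro k hk
    simp [toMatrix_unit, hk.symm]

theorem unit_mul_unit (i j k l : ℕ) :
    (unit i j * unit k l : FinitaryMatrix F) = if j = k then unit i l else 0 := by
  ext a b
  rw [toMatrix_unit_mul, toMatrix_unit]
  split_ifs <;> simp_all [toMatrix_unit]

theorem exists_entry_ne_zero {A : FinitaryMatrix F} (hA : A ≠ 0) :
    ∃ i j, A.toMatrix i j ≠ 0 := by
  by_contra! h
  exact hA (FinitaryMatrix.ext h)

/-- The entry (i, l) of A E_jk B is A_ij B_kl, so one nonzero entry of each factor suffices. -/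
theorem isElementwisePrime : IsElementwisePrime (FinitaryMatrix F) := by
  intro A B hA hB
  obtain ⟨i, j, hij⟩ := exists_entry_ne_zero hA
  obtain ⟨k, l, hkl⟩ := exists_entry_ne_zero hB
  refine ⟨unit j k, fun h => ?_⟩
  have := congrArg (fun X => X.toMatrix i l) h
  rw [mul_assoc] at this
  simp only [toMatrix_mul, toMatrix_zero, Matrix.zero_apply] at this
  rw [finsum_eq_single _ j] at this
  · have h2 := toMatrix_unit_mul B j k j l
    rw [toMatrix_mul] at h2
    rw [h2, if_pos rfl] at this
    exact mul_ne_zero hij hkl this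
  · intro m hm
    have h2 := toMatrix_unit_mul B j k m l
    rw [toMatrix_mul] at h2
    rw [h2, if_neg hm.symm, mul_zero]

/-- This is what makes a family of idempotents with local-unit sums infinite, hence indexable by ℕ.
-/
theorem not_exists_one : ¬ ∃ e : FinitaryMatrix F, ∀ a, e * a = a := by
  rintro ⟨e, he⟩
  obtain ⟨N, hN⟩ := e.exists_bound
  have h := congrArg (fun X => X.toMatrix N N) (he (unit N N))
  simp only [toMatrix_mul_unit, toMatrix_unit, and_self, if_true] at h
  have := (hN N N (h ▸ one_ne_zero)).1
  omega

/-- The matrix units form a basis of the algebra of finitary matrices. -/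
noncomputable def unitBasis (F : Type*) [Field F] :
    Module.Basis (ℕ × ℕ) F (FinitaryMatrix F) :=
  .ofRepr
  { toFun := fun A => Finsupp.ofSupportFinite (fun p => A.toMatrix p.1 p.2) A.finite
    map_add' := fun A B => by ext; rfl
    map_smul' := fun c A => by ext; rfl
    invFun := fun x => ⟨fun i j => x (i, j), x.hasFiniteSupport⟩
    left_inv := fun A => rfl
    right_inv := fun x => by ext; rfl }

theorem unitBasis_repr_apply (A : FinitaryMatrix F) (p : ℕ × ℕ) :
    (unitBasis F).repr A p = A.toMatrix p.1 p.2 := rfl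

theorem unitBasis_apply (p : ℕ × ℕ) : unitBasis F p = unit p.1 p.2 := by
  apply (unitBasis F).repr.injective
  ext q
  rw [(unitBasis F).repr_self, unitBasis_repr_apply, toMatrix_unit, Finsupp.single_apply]
  simp [Prod.ext_iff]

/-- The corner of a finitary idempotent is a matrix algebra. -/
theorem exists_corner_iso {e : FinitaryMatrix F} (he : e * e = e) :
    ∃ (n : ℕ) (ι : Matrix (Fin n) (Fin n) F →ₗ[F] FinitaryMatrix F),
      (∀ X Y, ι (X * Y) = ι X * ι Y) ∧ Function.Injective ι ∧ ι 1 = e ∧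
        LinearMap.range ι = peirceCorner F e e := by
  obtain ⟨N, hN⟩ := e.exists_bound
  obtain ⟨M, rfl⟩ := exists_ofBlock hN
  rw [← ofBlock_mul] at he
  obtain ⟨n, P, Q, hPQ, hQP⟩ := Matrix.exists_idempotent_factorization (ofBlock_injective N he)
  -- Conjugation by the factorization M = P Q; on the corner of M its inverse is Y ↦ Q Y P.
  let κ : Matrix (Fin n) (Fin n) F →ₗ[F] Matrix (Fin N) (Fin N) F :=
    { toFun := fun X => P * X * Q
      map_add' := fun X Y => by rw [Matrix.mul_add, Matrix.add_mul]
      map_smul' := fun c X => by simp }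
  have hκ (X) : κ X = P * X * Q := rfl
  have hback (X) : Q * κ X * P = X := by
    calc Q * (P * X * Q) * P = (Q * P) * X * (Q * P) := by simp only [Matrix.mul_assoc]
      _ = X := by simp [hQP]
  have hM1 : κ 1 = M := by rw [hκ, Matrix.mul_one, hPQ]
  have hmul (X Y) : κ (X * Y) = κ X * κ Y := by
    calc κ (X * Y) = P * X * (1 * Y) * Q := by simp [hκ, Matrix.mul_assoc]
      _ = κ X * κ Y := by rw [← hQP]; simp [hκ, Matrix.mul_assoc]
  refine ⟨n, ofBlock N ∘ₗ κ, ?_, ?_, ?_, ?_⟩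
  · intro X Y
    simp only [LinearMap.comp_apply, hmul, ofBlock_mul]
  · refine (ofBlock_injective N).comp fun X Y h => ?_
    rw [← hback X, ← hback Y, h]
  · rw [LinearMap.comp_apply, hM1]
  · apply le_antisymm
    · rintro _ ⟨X, rfl⟩
      constructor
      · rw [← hM1, LinearMap.comp_apply, ← ofBlock_mul, ← hmul, one_mul]
      · rw [← hM1, LinearMap.comp_apply, ← ofBlock_mul, ← hmul, mul_one]
    · rintro A ⟨h1, h2⟩
      -- From A = e A = A e, the matrix A vanishes outside the block that supports e.
      obtain ⟨Y, rfl⟩ : ∃ Y, ofBlock N Y = A := by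
        apply exists_ofBlock
        intro i j hij
        constructor
        · by_contra hi
          apply hij
          rw [← h1, toMatrix_mul_left hN]
          refine Finset.sum_eq_zero fun k _ => ?_
          have : (ofBlock N M).toMatrix i k = 0 := by
            by_contra h
            exact hi (hN i k h).1
          rw [this, zero_mul]
        · by_contra hj
          apply hij
          rw [← h2, toMatrix_mul_right hN]
          refine Finset.sum_eq_zero fun k _ => ?_
          have : (ofBlock N M).toMatrix k j = 0 := by
            by_contra h
            exact hj (hN k j h).2
          rw [this, mul_zero]
      rw [← ofBlock_mul] at h1 h2
      have h1 := ofBlock_injective N h1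
      have h2 := ofBlock_injective N h2
      refine ⟨Q * Y * P, ?_⟩
      rw [LinearMap.comp_apply]
      congr 1
      calc P * (Q * Y * P) * Q = (P * Q) * Y * (P * Q) := by simp only [Matrix.mul_assoc]
        _ = Y := by rw [hPQ, h1, h2]

theorem finiteDimensional_peirceCorner {e : FinitaryMatrix F} (he : e * e = e) :
    FiniteDimensional F (peirceCorner F e e) := by
  obtain ⟨n, ι, -, -, -, h⟩ := exists_corner_iso he
  rw [← h]
  infer_instance

end FinitaryMatrix

/-! ### Elementary gradings through matrix entries -/

section ElementaryGrading

variable {F G : Type*} [Field F] [CommGroup G]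

open FinitaryMatrix

/-- The component of degree `g` of the elementary grading defined by `γ`. -/
noncomputable def elementaryComponent (F : Type*) {G : Type*} [Field F] [Group G] (γ : ℕ → G) (g : G) :
    Submodule F (FinitaryMatrix F) :=
  Submodule.span F {E | ∃ i j, (γ i)⁻¹ * γ j = g ∧ E = unit i j}

theorem mem_elementaryComponent_iff {γ : ℕ → G} {g : G} {A : FinitaryMatrix F} :
    A ∈ elementaryComponent F γ g ↔ ∀ i j, A.toMatrix i j ≠ 0 → (γ i)⁻¹ * γ j = g := by
  have : {E : FinitaryMatrix F | ∃ i j, (γ i)⁻¹ * γ j = g ∧ E = unit i j} =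
      unitBasis F '' {p | (γ p.1)⁻¹ * γ p.2 = g} := by
    ext E
    constructor
    · rintro ⟨i, j, h, rfl⟩
      exact ⟨(i, j), h, unitBasis_apply _⟩
    · rintro ⟨⟨i, j⟩, h, rfl⟩
      exact ⟨i, j, h, unitBasis_apply _⟩
  rw [elementaryComponent, this, Module.Basis.mem_span_image]
  constructor
  · intro h i j hij
    exact h (a := (i, j)) (by simpa [unitBasis_repr_apply] using hij)
  · rintro h ⟨i, j⟩ hp
    exact h i j (by simpa [unitBasis_repr_apply] using hp)

theorem isGrading_elementaryComponent [Finite G] [DecidableEq G] (γ : ℕ → G) :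
    IsGrading (elementaryComponent F γ) := by
  have := Fintype.ofFinite G
  let π (g : G) : FinitaryMatrix F →ₗ[F] FinitaryMatrix F :=
    { toFun := fun A => ofEntries
        (.of fun i j => if (γ i)⁻¹ * γ j = g then A.toMatrix i j else 0) (by
          refine A.finite.subset ?_
          rintro ⟨i, j⟩ h h'
          exact h (by simp [h']))
      map_add' := fun A B => by
        ext i j
        by_cases h : (γ i)⁻¹ * γ j = g <;> simp [toMatrix_ofEntries, h]
      map_smul' := fun c A => by
        ext i j
        by_cases h : (γ i)⁻¹ * γ j = g <;> simp [toMatrix_ofEntries, h] }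
  have hπ (g : G) (A : FinitaryMatrix F) (i j : ℕ) :
      (π g A).toMatrix i j = if (γ i)⁻¹ * γ j = g then A.toMatrix i j else 0 := rfl
  have hsum (A : FinitaryMatrix F) : ∑ g, π g A = A := by
    apply (unitBasis F).repr.injective
    ext ⟨i, j⟩
    rw [map_sum, Finsupp.finsetSum_apply]
    simp [unitBasis_repr_apply, hπ]
  refine ⟨IsProjectionFamily.isInternal (π := π) ⟨?_, hsum, ?_, ?_⟩, ?_⟩
  · intro g A
    rw [mem_elementaryComponent_iff]
    intro i j h
    by_contra h'
    exact h (by rw [hπ, if_neg h'])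
  · intro g A hA
    rw [mem_elementaryComponent_iff] at hA
    ext i j
    rw [hπ]
    split_ifs with h
    · rfl
    · by_contra h'
      exact h (hA i j (Ne.symm h'))
  · intro g h hgh A hA
    rw [mem_elementaryComponent_iff] at hA
    ext i j
    rw [hπ]
    split_ifs with h1
    · by_contra h'
      exact hgh (h1.symm.trans (hA i j h'))
    · rfl
  · intro g h A B hA hB
    rw [mem_elementaryComponent_iff] at hA hB ⊢
    intro i j hij
    obtain ⟨k, hk⟩ : ∃ k, A.toMatrix i k * B.toMatrix k j ≠ 0 := by
      by_contra! H
      exact hij (by simp [toMatrix_mul, H])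
    rw [← hA i k (left_ne_zero_of_mul hk), ← hB k j (right_ne_zero_of_mul hk)]
    group

end ElementaryGrading

/-! ### An exhausting sequence of primitive idempotents -/

section Sequence

variable {F G : Type*} [Field F] [CommGroup G] [DecidableEq G] [Finite G]

open FinitaryMatrix

/-- A grading of the algebra of finitary matrices has a sequence of orthogonal primitive
homogeneous idempotents whose partial sums form local units. -/
theorem exists_primitive_sequence {ℛ : G → Submodule F (FinitaryMatrix F)}
    (hR : IsGrading ℛ) : ∃ f : ℕ → FinitaryMatrix F,
      (∀ i, IsPrimitiveHomogeneous ℛ (f i)) ∧ (∀ i j, i ≠ j → f i * f j = 0) ∧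
      ∀ a, ∃ s : Finset ℕ, (∑ i ∈ s, f i) * a = a ∧ a * (∑ i ∈ s, f i) = a := by
  classical
  let S (n : ℕ) : Finset (FinitaryMatrix F) :=
    (Finset.range n ×ˢ Finset.range n).image fun p => unitBasis F p
  let 𝒯 := {T : Finset (FinitaryMatrix F) // IsOrthogonalPrimitive ℛ (T : Set _)}
  have step (n : ℕ) (T : 𝒯) : ∃ T' : 𝒯, T.1 ⊆ T'.1 ∧
      ∀ s ∈ S n, (∑ f ∈ T'.1, f) * s = s ∧ s * (∑ f ∈ T'.1, f) = s := by
    obtain ⟨T', h1, h2, h3⟩ := hR.exists_orthogonalPrimitive_extension isVonNeumannRegular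
      (fun e he => finiteDimensional_peirceCorner he) T.1 T.2 (S n)
    exact ⟨⟨T', h2⟩, h1, h3⟩
  choose next hsub hunit using step
  let T : ℕ → 𝒯 := Nat.rec ⟨∅, ⟨by simp, by simp⟩⟩ next
  have hmono : Monotone fun n => (T n).1 := monotone_nat_of_le_succ fun n => hsub n (T n)
  have hloc (a : FinitaryMatrix F) :
      ∃ n, (∑ f ∈ (T n).1, f) * a = a ∧ a * (∑ f ∈ (T n).1, f) = a := by
    obtain ⟨N, hN⟩ := a.exists_bound
    -- Stage `T (N + 1)` is the one built to act as a unit on `S N`, the matrix units of the N × N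
    -- block.
    refine ⟨N + 1, ?_⟩
    have ha : a ∈ Submodule.span F (unitBasis F '' {p | p.1 < N ∧ p.2 < N}) := by
      rw [Module.Basis.mem_span_image]
      rintro ⟨i, j⟩ h
      exact hN i j (by simpa [unitBasis_repr_apply] using h)
    clear hN
    induction ha using Submodule.span_induction with
    | mem x hx =>
      obtain ⟨p, hp, rfl⟩ := hx
      exact hunit N (T N) _ (Finset.mem_image_of_mem _ (by simpa using hp))
    | zero => simp
    | add x y _ _ hx hy => exact ⟨by rw [mul_add, hx.1, hy.1], by rw [add_mul, hx.2, hy.2]⟩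
    | smul c x _ hx => exact ⟨by rw [mul_smul_comm, hx.1], by rw [smul_mul_assoc, hx.2]⟩
  let 𝓕 : Set (FinitaryMatrix F) := ⋃ n, ((T n).1 : Set (FinitaryMatrix F))
  have horth : ∀ f ∈ 𝓕, ∀ f' ∈ 𝓕, f ≠ f' → f * f' = 0 := by
    intro f hf f' hf' hne
    obtain ⟨n, hn⟩ := Set.mem_iUnion.1 hf
    obtain ⟨m, hm⟩ := Set.mem_iUnion.1 hf'
    exact (T (max n m)).2.orthogonal f (hmono (le_max_left n m) hn) f'
      (hmono (le_max_right n m) hm) hne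
  have hprim : ∀ f ∈ 𝓕, IsPrimitiveHomogeneous ℛ f := by
    intro f hf
    obtain ⟨n, hn⟩ := Set.mem_iUnion.1 hf
    exact (T n).2.primitive f hn
  have hcount : 𝓕.Countable := Set.countable_iUnion fun n => (T n).1.countable_toSet
  -- If the family were finite, its sum would fix every local unit and so be a left identity of the
  -- whole algebra.
  have hinf : 𝓕.Infinite := by
    intro hfin
    apply not_exists_one (F := F)
    refine ⟨∑ f ∈ hfin.toFinset, f, fun a => ?_⟩
    obtain ⟨n, hn, -⟩ := hloc a
    conv_lhs => rw [← hn, ← mul_assoc, Finset.mul_sum]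
    rw [Finset.sum_congr rfl (g := fun f => f), hn]
    intro f hf
    have hf' : f ∈ 𝓕 := Set.mem_iUnion.2 ⟨n, hf⟩
    rw [Finset.sum_mul, Finset.sum_eq_single f, (hprim f hf').idem]
    · intro f' h' hne
      exact horth f' (hfin.mem_toFinset.1 h') f hf' hne
    · exact fun h => absurd (hfin.mem_toFinset.2 hf') h
  have := hcount.to_subtype
  have := hinf.to_subtype
  obtain ⟨D⟩ := nonempty_denumerable 𝓕
  let ε : ℕ ≃ 𝓕 := (Denumerable.eqv 𝓕).symm
  have hinj : Function.Injective fun i => (ε i).1 := Subtype.val_injective.comp ε.injective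
  refine ⟨fun i => (ε i).1, fun i => hprim _ (ε i).2,
    fun i j hij => horth _ (ε i).2 _ (ε j).2 (hinj.ne hij), fun a => ?_⟩
  obtain ⟨n, hn⟩ := hloc a
  -- The enumeration need not respect the stages, so the index set is the preimage of a stage, not
  -- an initial segment.
  refine ⟨(T n).1.preimage (fun i => (ε i).1) hinj.injOn, ?_⟩
  rw [Finset.sum_preimage (fun i => (ε i).1) (T n).1 hinj.injOn fun f => f]
  · exact hn
  · intro f hf hf'
    exact absurd ⟨ε.symm ⟨f, Set.mem_iUnion.2 ⟨n, hf⟩⟩, by simp⟩ hf'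

end Sequence

/-! ### Reconstruction of the ring from a corner -/

open FinitaryMatrix

theorem FinitaryMatrix.tensor_induction {F : Type*} [Field F] {B : Type*} [AddCommGroup B]
    [Module F B] {P : FinitaryMatrix F ⊗[F] B → Prop} (zero : P 0)
    (add : ∀ x y, P x → P y → P (x + y)) (unit_tmul : ∀ i j b, P (unit i j ⊗ₜ[F] b))
    (x : FinitaryMatrix F ⊗[F] B) : P x := by
  obtain ⟨y, rfl⟩ := (TensorProduct.equivFinsuppOfBasisLeft (N := B) (unitBasis F)).symm.surjective x
  induction y using Finsupp.induction_linear with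
  | zero => simpa using zero
  | add x y hx hy => rw [map_add]; exact add _ _ hx hy
  | single p b =>
    rw [TensorProduct.equivFinsuppOfBasisLeft_symm_apply, Finsupp.sum_single_index (by simp),
      unitBasis_apply]
    exact unit_tmul _ _ _

/-- Homogeneous elements `u i`, `v i` connecting an idempotent `e` to a complete orthogonal
sequence of idempotents `v i * u i`. -/
structure IsConnectingSystem {F G R : Type*} [Field F] [Group G] [NonUnitalRing R] [Module F R]
    (ℛ : G → Submodule F R) (e : R) (γ : ℕ → G) (u v : ℕ → R) : Prop where
  u_mem : ∀ i, u i ∈ ℛ (γ i)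
  v_mem : ∀ i, v i ∈ ℛ (γ i)⁻¹
  e_mul_u : ∀ i, e * u i = u i
  v_mul_e : ∀ i, v i * e = v i
  u_mul_v : ∀ i, u i * v i = e
  u_mul_v_of_ne : ∀ i j, i ≠ j → u i * v j = 0
  exists_local_unit : ∀ a, ∃ s : Finset ℕ,
    (∑ i ∈ s, v i * u i) * a = a ∧ a * (∑ i ∈ s, v i * u i) = a

/-- A connecting system identifies the ring with infinite matrices over the corner of `e`. -/
theorem IsConnectingSystem.gradedIsomorphic {F G R : Type*} [Field F] [CommGroup G]
    [DecidableEq G] [NonUnitalRing R] [Module F R] [IsScalarTower F R R] [SMulCommClass F R R]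
    {ℛ : G → Submodule F R} (hR : IsGrading ℛ) {e : R}
    {γ : ℕ → G} {u v : ℕ → R} (h : IsConnectingSystem ℛ e γ u v) {B : Type*} [Ring B]
    [Algebra F B] (ι : B →ₗ[F] R) (hmul : ∀ X Y, ι (X * Y) = ι X * ι Y)
    (hinj : Function.Injective ι) (hrange : LinearMap.range ι = peirceCorner F e e) :
    GradedIsomorphic ℛ
      (tensorGrading (elementaryComponent F γ) fun g => (ℛ g).comap ι) := by
  classical
  have hcorner (X : B) : e * ι X = ι X ∧ ι X * e = ι X := by
    have : ι X ∈ peirceCorner F e e := hrange ▸ LinearMap.mem_range_self ι X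
    exact this
  let ψ₀ : (ℕ × ℕ →₀ B) →ₗ[F] R := Finsupp.lsum F fun p =>
    LinearMap.mulRight F (u p.2) ∘ₗ LinearMap.mulLeft F (v p.1) ∘ₗ ι
  let ε := TensorProduct.equivFinsuppOfBasisLeft (N := B) (unitBasis F)
  let ψ : FinitaryMatrix F ⊗[F] B →ₗ[F] R := ψ₀ ∘ₗ ε.toLinearMap
  have hψ₀ (p : ℕ × ℕ) (X : B) : ψ₀ (Finsupp.single p X) = v p.1 * ι X * u p.2 := by
    simp [ψ₀]
  have hψ (i j : ℕ) (X : B) : ψ (unit i j ⊗ₜ X) = v i * ι X * u j := by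
    have : ε (unit i j ⊗ₜ X) = Finsupp.single (i, j) X := by
      rw [← LinearEquiv.eq_symm_apply, TensorProduct.equivFinsuppOfBasisLeft_symm_apply,
        Finsupp.sum_single_index (by simp), unitBasis_apply]
    rw [LinearMap.comp_apply, LinearEquiv.coe_coe, this, hψ₀]
  -- The products u i * a * v j recover the matrix entries of a, whence injectivity.
  have hentry (x : ℕ × ℕ →₀ B) (i j : ℕ) : u i * ψ₀ x * v j = ι (x (i, j)) := by
    induction x using Finsupp.induction_linear with
    | zero => simp
    | add x y hx hy => rw [map_add, mul_add, add_mul, hx, hy, Finsupp.add_apply, map_add]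
    | single p X =>
      obtain ⟨k, l⟩ := p
      have e1 : u i * (v k * ι X * u l) * v j = (u i * v k) * ι X * (u l * v j) := by
        simp only [mul_assoc]
      rw [hψ₀, e1, Finsupp.single_apply]
      by_cases hik : i = k
      · by_cases hlj : l = j
        · subst hik hlj
          rw [h.u_mul_v, h.u_mul_v, (hcorner X).1, (hcorner X).2, if_pos rfl]
        · rw [h.u_mul_v_of_ne _ _ hlj, mul_zero, if_neg (by simp [hlj]), map_zero]
      · rw [h.u_mul_v_of_ne _ _ hik, zero_mul, zero_mul,
          if_neg (by simp [Ne.symm hik]), map_zero]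
  have hψmul (x y) : ψ (x * y) = ψ x * ψ y := by
    induction x using tensor_induction with
    | zero => simp
    | add x x' hx hx' => rw [add_mul, map_add, map_add, add_mul, hx, hx']
    | unit_tmul i j X =>
      induction y using tensor_induction with
      | zero => simp
      | add y y' hy hy' => rw [mul_add, map_add, map_add, mul_add, hy, hy']
      | unit_tmul k l Y =>
        have e1 : v i * ι X * u j * (v k * ι Y * u l) = v i * (ι X * (u j * v k) * ι Y) * u l := by
          simp only [mul_assoc]
        rw [Algebra.TensorProduct.tmul_mul_tmul, unit_mul_unit, hψ, hψ, e1]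
        by_cases hjk : j = k
        · subst hjk
          rw [if_pos rfl, hψ, h.u_mul_v, (hcorner X).2, hmul]
        · rw [if_neg hjk, h.u_mul_v_of_ne _ _ hjk]
          simp
  have hψinj : Function.Injective ψ := by
    refine Function.Injective.comp (g := ψ₀) (f := ε) ?_ ε.injective
    intro x y hxy
    ext ⟨i, j⟩
    exact hinj (by rw [← hentry, ← hentry, hxy])
  have hle (g : G) : ∀ x ∈ tensorGrading (elementaryComponent F γ) (fun g => (ℛ g).comap ι) g,
      ψ x ∈ ℛ g := by
    intro x hx
    induction hx using Submodule.span_induction with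
    | zero => simp
    | add x y _ _ hx hy => rw [map_add]; exact add_mem hx hy
    | smul c x _ hx => rw [map_smul]; exact Submodule.smul_mem _ _ hx
    | mem x hx =>
      obtain ⟨p, k, hpk, a, ha, b, hb, rfl⟩ := hx
      induction ha using Submodule.span_induction with
      | zero => simp
      | add x y _ _ hx hy => rw [TensorProduct.add_tmul, map_add]; exact add_mem hx hy
      | smul c x _ hx =>
        rw [← TensorProduct.smul_tmul', map_smul]; exact Submodule.smul_mem _ _ hx
      | mem x hx =>
        obtain ⟨i, j, hij, rfl⟩ := hx
        rw [hψ]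
        refine hR.mul_mem_of_eq (hR.mul_mem _ _ _ _ (h.v_mem i) hb) (h.u_mem j) ?_
        -- Commutativity of G enters here: the degree γᵢ⁻¹ k γⱼ must equal (γᵢ⁻¹γⱼ) k.
        rw [← hpk, ← hij, mul_right_comm]
  have hge (g : G) : ∀ a ∈ ℛ g,
      ∃ x ∈ tensorGrading (elementaryComponent F γ) (fun g => (ℛ g).comap ι) g, ψ x = a := by
    intro a ha
    obtain ⟨s, hs1, hs2⟩ := h.exists_local_unit a
    -- Surjectivity: local units on both sides expand a as the sum of the vᵢ (uᵢ a vⱼ) uⱼ, with the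
    -- middle factors in the corner of e.
    have hX (i j : ℕ) : ∃ X, ι X = u i * a * v j := by
      have : u i * a * v j ∈ peirceCorner F e e :=
        ⟨by rw [← mul_assoc, ← mul_assoc, h.e_mul_u], by rw [mul_assoc, h.v_mul_e]⟩
      rw [← hrange] at this
      exact this
    choose X hX using hX
    refine ⟨∑ i ∈ s, ∑ j ∈ s, unit i j ⊗ₜ X i j, ?_, ?_⟩
    · refine sum_mem fun i _ => sum_mem fun j _ => Submodule.subset_span
        ⟨(γ i)⁻¹ * γ j, γ i * g * (γ j)⁻¹, ?_, unit i j,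
          Submodule.subset_span ⟨i, j, rfl, rfl⟩, X i j, ?_, rfl⟩
      · rw [mul_comm (γ i) g, mul_comm (γ i)⁻¹]
        simp [mul_assoc, mul_comm g]
      · rw [Submodule.mem_comap, hX]
        exact hR.mul_mem _ _ _ _ (hR.mul_mem _ _ _ _ (h.u_mem i) ha) (h.v_mem j)
    · have : (∑ i ∈ s, v i * u i) * a * (∑ j ∈ s, v j * u j) = a := by rw [hs1, hs2]
      rw [Finset.sum_mul, Finset.sum_mul] at this
      conv_rhs => rw [← this]
      rw [map_sum]
      refine Finset.sum_congr rfl fun i _ => ?_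
      rw [map_sum, Finset.mul_sum]
      refine Finset.sum_congr rfl fun j _ => ?_
      rw [hψ, hX]
      simp only [mul_assoc]
  have hψsurj : Function.Surjective ψ := by
    intro a
    have hrange : LinearMap.range ψ = ⊤ := by
      rw [eq_top_iff, ← hR.isInternal.submodule_iSup_eq_top, iSup_le_iff]
      intro g a ha
      obtain ⟨x, -, hx⟩ := hge g a ha
      exact ⟨x, hx⟩
    exact LinearMap.range_eq_top.1 hrange a
  let Ψ := LinearEquiv.ofBijective ψ ⟨hψinj, hψsurj⟩
  have hΨ (x) : Ψ x = ψ x := rfl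
  let φ : R →ₙₐ[F] FinitaryMatrix F ⊗[F] B :=
    { toFun := Ψ.symm
      map_smul' := map_smul Ψ.symm
      map_zero' := map_zero Ψ.symm
      map_add' := map_add Ψ.symm
      map_mul' := fun a b => by
        apply Ψ.injective
        simp [hΨ, hψmul]
        simp [← hΨ] }
  refine ⟨φ, Ψ.symm.bijective, fun g => ?_⟩
  ext x
  constructor
  · rintro ⟨a, ha, rfl⟩
    obtain ⟨x, hx, rfl⟩ := hge g a ha
    have : φ (ψ x) = x := Ψ.symm_apply_apply x
    simpa [this] using hx
  · intro hx
    exact ⟨ψ x, hle g x hx, Ψ.symm_apply_apply x⟩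

/-! ### The grading and support of the corner; connecting elements -/

section Corner

variable {F G R : Type*} [Field F] [CommGroup G] [DecidableEq G] [Finite G] [NonUnitalRing R]
  [Module F R] [IsScalarTower F R R] [SMulCommClass F R R] {ℛ : G → Submodule F R}

/-- The grading induced on a ring identified with the corner of a homogeneous idempotent. -/
theorem IsGrading.comap_corner (hR : IsGrading ℛ) {e : R} (he : e ∈ ℛ 1) {B : Type*} [Ring B]
    [Algebra F B] (ι : B →ₗ[F] R) (hmul : ∀ X Y, ι (X * Y) = ι X * ι Y)
    (hinj : Function.Injective ι) (hrange : LinearMap.range ι = peirceCorner F e e) :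
    IsGrading fun g => (ℛ g).comap ι := by
  have := Fintype.ofFinite G
  obtain ⟨π, hπ⟩ := hR.isInternal.exists_projectionFamily
  -- As e has degree 1, multiplication by e commutes with the projections, which therefore preserve
  -- the corner.
  have hl (g : G) (x : R) : π g (e * x) = e * π g x := by
    conv_lhs => rw [← hπ.sum x, Finset.mul_sum, map_sum]
    rw [Finset.sum_eq_single g]
    · exact hπ.same _ _ (hR.mul_mem_of_eq he (hπ.mem g x) (one_mul g))
    · intro k _ hk
      exact hπ.ne g k hk.symm _ (hR.mul_mem_of_eq he (hπ.mem k x) (one_mul k))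
    · simp
  have hr (g : G) (x : R) : π g (x * e) = π g x * e := by
    conv_lhs => rw [← hπ.sum x, Finset.sum_mul, map_sum]
    rw [Finset.sum_eq_single g]
    · exact hπ.same _ _ (hR.mul_mem_of_eq (hπ.mem g x) he (mul_one g))
    · intro k _ hk
      exact hπ.ne g k hk.symm _ (hR.mul_mem_of_eq (hπ.mem k x) he (mul_one k))
    · simp
  obtain ⟨ρ, hρ⟩ := ι.exists_leftInverse_of_injective (LinearMap.ker_eq_bot.2 hinj)
  have hι (g : G) (X : B) : ι (ρ (π g (ι X))) = π g (ι X) := by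
    have hX : ι X ∈ peirceCorner F e e := hrange ▸ LinearMap.mem_range_self ι X
    have : π g (ι X) ∈ LinearMap.range ι := by
      rw [hrange]
      exact ⟨by rw [← hl, hX.1], by rw [← hr, hX.2]⟩
    obtain ⟨Y, hY⟩ := this
    rw [← hY]
    exact congrArg ι (LinearMap.congr_fun hρ Y)
  refine ⟨IsProjectionFamily.isInternal (π := fun g => ρ ∘ₗ π g ∘ₗ ι) ⟨?_, ?_, ?_, ?_⟩, ?_⟩
  · intro g X
    simpa [hι] using hπ.mem g (ι X)
  · intro X
    apply hinj
    simp only [map_sum, LinearMap.comp_apply, hι]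
    exact hπ.sum _
  · intro g X hX
    apply hinj
    simp only [LinearMap.comp_apply, hι]
    exact hπ.same _ _ hX
  · intro g k hgk X hX
    apply hinj
    simp only [LinearMap.comp_apply, hι, map_zero]
    exact hπ.ne _ _ hgk _ hX
  · intro g k X Y hX hY
    rw [Submodule.mem_comap, hmul]
    exact hR.mul_mem _ _ _ _ hX hY

/-- The degrees of the nonzero homogeneous elements of a primitive corner. -/
def IsPrimitiveHomogeneous.support (hR : IsGrading ℛ) (hreg : IsVonNeumannRegular R) {e : R}
    (he : IsPrimitiveHomogeneous ℛ e) : Subgroup G where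
  carrier := {g | ∃ d ∈ ℛ g, d ∈ peirceCorner F e e ∧ d ≠ 0}
  one_mem' := ⟨e, he.mem, ⟨he.idem, he.idem⟩, he.ne_zero⟩
  mul_mem' := by
    rintro g k ⟨a, ha, hae, ha0⟩ ⟨b, hb, hbe, hb0⟩
    refine ⟨a * b, hR.mul_mem _ _ _ _ ha hb,
      ⟨by rw [← mul_assoc, hae.1], by rw [mul_assoc, hbe.2]⟩, fun h0 => hb0 ?_⟩
    obtain ⟨y, -, -, -, -, hya⟩ := he.exists_inverse hR hreg he ha hae.1 hae.2 ha0
    rw [← hbe.1, ← hya, mul_assoc, h0, mul_zero]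
  inv_mem' := by
    rintro g ⟨a, ha, hae, ha0⟩
    obtain ⟨y, hy, hey, hye, hay, -⟩ := he.exists_inverse hR hreg he ha hae.1 hae.2 ha0
    refine ⟨y, hy, ⟨hey, hye⟩, fun h0 => he.ne_zero ?_⟩
    rw [← hay, h0, mul_zero]

/-- The degree of a connecting element can be any prescribed representative modulo the support of
the corner. -/
theorem IsPrimitiveHomogeneous.exists_connecting (hR : IsGrading ℛ)
    (hreg : IsVonNeumannRegular R) (hprime : IsElementwisePrime R) {e f : R}
    (he : IsPrimitiveHomogeneous ℛ e) (hf : IsPrimitiveHomogeneous ℛ f) :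
    ∃ x : G ⧸ he.support hR hreg, ∃ a ∈ ℛ x.out, ∃ b ∈ ℛ x.out⁻¹,
      e * a = a ∧ a * f = a ∧ f * b = b ∧ b * e = b ∧ a * b = e ∧ b * a = f := by
  obtain ⟨g, r, hr, h0⟩ := hR.exists_homogeneous_mul_ne_zero hprime he.ne_zero hf.ne_zero
  -- The chosen representative of the coset of g is g t with t in the support; an invertible d of
  -- degree t in the corner corrects the degree of e r f to it without making it zero.
  obtain ⟨⟨t, d, hd, hde, hd0⟩, ht⟩ := QuotientGroup.mk_out_eq_mul (he.support hR hreg) g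
  obtain ⟨y, -, -, -, -, hyd⟩ := he.exists_inverse hR hreg he hd hde.1 hde.2 hd0
  have h1 : e * r * f ∈ ℛ g :=
    hR.mul_mem_of_eq (hR.mul_mem_of_eq he.mem hr (one_mul g)) hf.mem (mul_one g)
  have h2 : d * (e * r * f) ≠ 0 := by
    intro h
    apply h0
    calc e * r * f = e * (e * r * f) := by rw [← mul_assoc, ← mul_assoc, he.idem]
      _ = y * (d * (e * r * f)) := by rw [← mul_assoc y, hyd]
      _ = 0 := by rw [h, mul_zero]
  have h3 : d * (e * r * f) ∈ ℛ (QuotientGroup.mk (s := he.support hR hreg) g).out :=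
    hR.mul_mem_of_eq hd h1 (by rw [ht, mul_comm])
  have h4 : e * (d * (e * r * f)) = d * (e * r * f) := by rw [← mul_assoc, hde.1]
  have h5 : d * (e * r * f) * f = d * (e * r * f) := by simp only [mul_assoc, hf.idem]
  obtain ⟨b, hb, hfb, hbe, hab, hba⟩ := he.exists_inverse hR hreg hf h3 h4 h5 h2
  exact ⟨_, _, h3, b, hb, h4, h5, hfb, hbe, hab, hba⟩

end Corner

/-! ### Assembly of the graded tensor decomposition -/

theorem theorem5 {F G : Type*} [Field F] [IsAlgClosed F] [CharZero F]
    [CommGroup G] [Finite G] [DecidableEq G]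
    (ℛ : G → Submodule F (FinitaryMatrix F)) (hR : IsGrading ℛ) :
    ∃ (n : ℕ) (𝒞 : G → Submodule F (FinitaryMatrix F))
      (𝒟 : G → Submodule F (Matrix (Fin n) (Fin n) F)),
      0 < n ∧
      IsGrading 𝒞 ∧ IsElementaryGrading 𝒞 ∧
      IsGrading 𝒟 ∧ IsFineGrading 𝒟 ∧
      gradingSupport 𝒞 ∩ gradingSupport 𝒟 = {1} ∧
      GradedIsomorphic ℛ (tensorGrading 𝒞 𝒟) := by
  have hreg : IsVonNeumannRegular (FinitaryMatrix F) := isVonNeumannRegular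
  obtain ⟨f, hf, horth, hloc⟩ := exists_primitive_sequence hR
  have he := hf 0
  have := finiteDimensional_peirceCorner he.idem
  obtain ⟨n, ι, hmul, hinj, hone, hrange⟩ := exists_corner_iso he.idem
  have hcorner (X) : ι X ∈ peirceCorner F (f 0) (f 0) := hrange ▸ LinearMap.mem_range_self ι X
  choose x u hu v hv hu1 hu2 hv1 hv2 huv hvu using fun i =>
    he.exists_connecting hR hreg isElementwisePrime (hf i)
  have hsys : IsConnectingSystem ℛ (f 0) (fun i => (x i).out) u v :=
    { u_mem := hu
      v_mem := hv
      e_mul_u := hu1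
      v_mul_e := hv2
      u_mul_v := huv
      u_mul_v_of_ne := fun i j hij => by
        rw [← hu2, ← hv1, mul_assoc, ← mul_assoc (f i), horth i j hij, zero_mul, mul_zero]
      exists_local_unit := fun a => by simpa only [hvu] using hloc a }
  refine ⟨n, elementaryComponent F fun i => (x i).out, fun g => (ℛ g).comap ι, ?_,
    isGrading_elementaryComponent _, ⟨_, fun g => rfl⟩,
    hR.comap_corner he.mem ι hmul hinj hrange, ?_, ?_,
    hsys.gradedIsomorphic hR ι hmul hinj hrange⟩
  · rw [Nat.pos_iff_ne_zero]
    rintro rfl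
    apply he.ne_zero
    rw [← hone, Subsingleton.elim (1 : Matrix (Fin 0) (Fin 0) F) 0, map_zero]
  · intro g hg
    obtain ⟨X, hX, hX0⟩ := Submodule.exists_mem_ne_zero_of_ne_bot hg
    refine finrank_eq_one_iff'.2 ⟨⟨X, hX⟩, fun h => hX0 (congrArg Subtype.val h), ?_⟩
    rintro ⟨Y, hY⟩
    obtain ⟨c, hc⟩ := he.exists_smul_eq_of_mem hR hreg hX hY (hcorner X) (hcorner Y)
      (by simpa using hinj.ne hX0)
    exact ⟨c, Subtype.ext (hinj (by simpa using hc.symm))⟩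
  · ext g
    constructor
    · rintro ⟨hC, hD⟩
      obtain ⟨A, hA, hA0⟩ := Submodule.exists_mem_ne_zero_of_ne_bot hC
      obtain ⟨X, hX, hX0⟩ := Submodule.exists_mem_ne_zero_of_ne_bot hD
      obtain ⟨i, j, hij⟩ := exists_entry_ne_zero hA0
      have hg := mem_elementaryComponent_iff.1 hA i j hij
      -- A common degree puts the two representatives in the same coset of the support of the
      -- corner, so they coincide and the degree is 1.
      have hmem : (x i).out⁻¹ * (x j).out ∈ he.support hR hreg :=
        hg ▸ ⟨ι X, hX, hcorner X, by simpa using hinj.ne hX0⟩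
      have hxx : x i = x j := by
        rw [← QuotientGroup.out_eq' (x i), ← QuotientGroup.out_eq' (x j)]
        exact QuotientGroup.eq.2 hmem
      rw [Set.mem_singleton_iff, ← hg, hxx, inv_mul_cancel]
    · rintro rfl
      constructor
      · refine Submodule.ne_bot_iff _ |>.2 ⟨unit 0 0, Submodule.subset_span ⟨0, 0, by simp, rfl⟩, ?_⟩
        intro h
        have := congrArg (fun A => A.toMatrix 0 0) h
        simp [toMatrix_unit] at this
      · refine Submodule.ne_bot_iff _ |>.2 ⟨1, ?_, ?_⟩
        · rw [Submodule.mem_comap, hone]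
          exact he.mem
        · intro h
          apply he.ne_zero
          rw [← hone, h, map_zero]
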